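/- Consider the p-system $v_t-u_x=0$, $u_t+p_x=0$ with $v=1/\rho$ and $p=\rho^3/3$, with Riemann invariants $w_1=\rho-u$, $w_2=\rho+u$. For left state $U^-=(u^-,\rho^-)$ and right state $U^+=(u^+,\rho^+)$ with positive densities, an elementary 1-wave is either a 1-rarefaction ($w_2^-=w_2^+$, $\rho^+\le\rho^-$) or a 1-shock ($\rho^+>\rho^-$ and the Rankine--Hugoniot equations hold for some speed $\lambda<0$); an elementary 2-wave is either a 2-rarefaction ($w_1^-=w_1^+$, $\rho^-\le\rho^+$) or a 2-shock ($\rho^+<\rho^-$ and the Rankine--Hugoniot equations hold for some speed $\lambda>0$). The exact Riemann solution consists of a 1-wave followed by a 2-wave. For $c>0$, a *front tracking approximate solution with speeds $\pm c$ and exact wave strengths* is a map $(t,x)\mapsto U=(u,\rho)$, $t\ge0$, $\rho\ge0$, with right continuous profiles, for which there are finitely many jump fronts, 1-fronts $x=a-ct$ $(a\in A)$ and 2-fronts $x=b+ct$ $(b\in B)$, such that: (i) $U(t,\cdot)$ is continuous away from the jump fronts; (ii) the continuous waves (rarefactions and compressions, regarded as continua of infinitesimal fronts) travel with the same speeds and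 cross each other with unchanged strength, i.e. $w_1$ is constant along each line $x=y-ct$ with $y\notin A$ as long as this line meets no 2-front, and $w_2$ is constant along each line $x=y+ct$ with $y\notin B$ as long as this line meets no 1-front; (iii) at every $(t,x)$, $t\geq 0$, with $\rho(t,x)>0$ the limits $U(t,x-)=L$ and $U(t',x')\to M$ as $(t',x')\to(t,x)$ in the sector $t'>t$, $|x'-x|<c(t'-t)$, exist, and $M$ is the middle state of the exact Riemann solution with left state $L$ and right state $U(t,x)=U(t,x+)$. In particular, at every interaction the outgoing wave strengths are those of the exact Riemann solution. **Statement.** There are an initial profile $(\bar u,\bar\rho)$ of bounded variation on $\mathbb R$ and a $\rho_0>0$ with $\bar\rho(x)\ge\rho_0$ for all $x$, such that for every $c>0$ there exist a front tracking approximate solution $U=(u,\rho)$ with speeds $\pm c$ and exact wave strengths, with $U(0,\cdot)=(\bar u,\bar\rho)$, times $0<t_2<t_3$ and a point $x_2$ such that: 1. $\rho(t,x)>0$ for all $t\ge0$ and $x\in\mathbb R$ with $(t,x)\ne(t_2,x_2)$; 2. the total variation blows up at time $t_2$: $u(t,\cdot)$ and $\rho(t,\cdot)$ have bounded variation on $\mathbb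 R$ for $0\le t<t_2$, and $\mathrm{Tot.Var.}\{\rho(t,\cdot);\mathbb R\}\to\infty$ as $t\to t_2-$; 3. $\rho(t_3,x)\ge1$ for all $x\ge0$, and $\mathrm{Tot.Var.}\{\rho(t_3,\cdot);[0,\infty)\}=\infty$; 4. no continuous weights on wave strengths control the total variation: for all functions $W_1,W_2$ of the left and right state of a wave that are continuous and positive on the set where both densities are positive (with no restriction near vacuum), the weighted total variation of $U(0,\cdot)$ on $\mathbb R$ is finite, while that of $U(t_3,\cdot)$ on $[0,\infty)$ is infinite. Here the weighted total variation of a profile $V$ on a set $S\subseteq\mathbb R$ is the limit superior, as the finite set $\{y_0<\dots<y_n\}\subset S$ is refined, of $\sum_{i=1}^n \big(W_1(V(y_{i-1}),V(y_i))\,|w_1(V(y_i))-w_1(V(y_{i-1}))|+W_2(V(y_{i-1}),V(y_i))\,|w_2(V(y_i))-w_2(V(y_{i-1}))|\big)$. -/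

import Mathlib

open Set Filter Topology
open scoped ENNReal

namespace PSystem

/-- A gas state `(u, ρ)`: velocity and density. -/
abbrev State := ℝ × ℝ

/-- The first Riemann invariant `w₁ = ρ - u`. -/
def w₁ (U : State) : ℝ := U.2 - U.1

/-- The second Riemann invariant `w₂ = ρ + u`. -/
def w₂ (U : State) : ℝ := U.2 + U.1

/-- The Rankine-Hugoniot equations of `v_t - u_x = 0`, `u_t + p_x = 0`, with `v = 1 / ρ` and
`p = ρ ^ 3 / 3`, for a jump of speed `s` with left state `U` and right state `V`. -/
def RankineHugoniot (s : ℝ) (U V : State) : Prop :=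
  s * (1 / V.2 - 1 / U.2) = U.1 - V.1 ∧ s * (V.1 - U.1) = V.2 ^ 3 / 3 - U.2 ^ 3 / 3

/-- `U` (left) and `V` (right) are joined by an elementary wave of the first family: a centered
1-rarefaction (possibly of strength zero) or an entropy admissible 1-shock. -/
def Wave₁ (U V : State) : Prop :=
  0 < U.2 ∧ 0 < V.2 ∧
    ((w₂ U = w₂ V ∧ V.2 ≤ U.2) ∨ (U.2 < V.2 ∧ ∃ s < 0, RankineHugoniot s U V))

/-- `U` (left) and `V` (right) are joined by an elementary wave of the second family: a centered
2-rarefaction (possibly of strength zero) or an entropy admissible 2-shock. -/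
def Wave₂ (U V : State) : Prop :=
  0 < U.2 ∧ 0 < V.2 ∧
    ((w₁ U = w₁ V ∧ U.2 ≤ V.2) ∨ (V.2 < U.2 ∧ ∃ s > 0, RankineHugoniot s U V))

/-- `M` is the middle state of the exact solution of the Riemann problem with left state `L` and
right state `R`: a 1-wave from `L` to `M` followed by a 2-wave from `M` to `R`. -/
def RiemannMiddle (L M R : State) : Prop := Wave₁ L M ∧ Wave₂ M R

/-- The space-time sector issuing upwards from `(t, x)` and bounded by the two lines of
speed `-c` and `c`. -/
def upperSector (c t x : ℝ) : Set (ℝ × ℝ) := {p | t < p.1 ∧ |p.2 - x| < c * (p.1 - t)}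

/-- `U t x`, for `t ≥ 0`, is a front tracking approximate solution in which all 1-waves travel with
speed `-c`, all 2-waves travel with speed `c`, and wave strengths are exact.
There are finitely many jump fronts: the 1-fronts `x = a - c t` with `a ∈ A` and the 2-fronts
`x = b + c t` with `b ∈ B`. All the other waves are continuous. -/
def IsFrontTracking (c : ℝ) (U : ℝ → ℝ → State) : Prop :=
  (∀ t ≥ 0, ∀ x, 0 ≤ (U t x).2) ∧
  -- profiles are right continuous
  (∀ t ≥ 0, ∀ x, ContinuousWithinAt (U t) (Ici x) x) ∧
  -- at every point without vacuum the waves leaving the point are those of the exact solution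
  -- of the Riemann problem determined by the one-sided limits of the profile there
  (∀ t ≥ 0, ∀ x, 0 < (U t x).2 → ∃ L M : State,
    Tendsto (U t) (𝓝[<] x) (𝓝 L) ∧
    Tendsto (fun p : ℝ × ℝ => U p.1 p.2) (𝓝[upperSector c t x] (t, x)) (𝓝 M) ∧
    RiemannMiddle L M (U t x)) ∧
  ∃ A B : Finset ℝ,
    -- profiles are continuous away from the jump fronts
    (∀ t ≥ 0, ∀ x, x + c * t ∉ A → x - c * t ∉ B → ContinuousAt (U t) x) ∧
    -- until they meet a jump front of the other family, continuous 1-waves are carried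
    -- along `x = y - c t` with unchanged `w₁` ...
    (∀ y, y ∉ A → ∀ t t', 0 ≤ t → t ≤ t' →
      (∀ r ∈ Icc t t', (y - c * r) - c * r ∉ B) →
      w₁ (U t' (y - c * t')) = w₁ (U t (y - c * t))) ∧
    -- ... and continuous 2-waves along `x = y + c t` with unchanged `w₂`
    (∀ y, y ∉ B → ∀ t t', 0 ≤ t → t ≤ t' →
      (∀ r ∈ Icc t t', (y + c * r) + c * r ∉ A) →
      w₂ (U t' (y + c * t')) = w₂ (U t (y + c * t)))

/-- The total strength of the waves of the profile `V` seen on a list of points, the change of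
`w₁` (resp. `w₂`) between the states `P` and `Q` being weighted by `W₁ (P, Q)`
(resp. `W₂ (P, Q)`). -/
noncomputable def weightedSum (W₁ W₂ : State × State → ℝ) (V : ℝ → State) : List ℝ → ℝ≥0∞
  | x :: y :: l =>
      ENNReal.ofReal (W₁ (V x, V y) * |w₁ (V y) - w₁ (V x)| +
        W₂ (V x, V y) * |w₂ (V y) - w₂ (V x)|) + weightedSum W₁ W₂ V (y :: l)
  | _ => 0

/-- The weighted total variation of the profile `V` on `S`: the limit (superior) of the weighted
sums over the finite subsets of `S`, as these are refined. -/
noncomputable def weightedVariation (W₁ W₂ : State × State → ℝ) (V : ℝ → State) (S : Set ℝ) :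
    ℝ≥0∞ :=
  limsup (fun F : Finset S => weightedSum W₁ W₂ V ((F.sort (· ≤ ·)).map (fun x => (x : ℝ)))) atTop

/-- A weight on wave strengths: a function of the left and right states of a wave, continuous and
positive where the densities are positive, with no restriction on its behaviour near vacuum. -/
def IsWeight (W : State × State → ℝ) : Prop :=
  ContinuousOn W {p | 0 < p.1.2 ∧ 0 < p.2.2} ∧ ∀ p : State × State, 0 < p.1.2 → 0 < p.2.2 → 0 < W p

end PSystem

/-! In the labels `p = x + c t`, `q = x - c t` the solution is explicit. Its only jump front is the
1-shock `p = 1`. `w₁` depends on `p` alone: it falls from 1 to 0 (a rarefaction), jumps to 1 across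
the shock, then rises to 3 (a compression). On each side of the shock `w₂` depends on `q` alone.

Near vacuum the shock amplifies 2-waves. For a jump of `w₁` from 0 to 1 with density ratio `s ^ 2`,
Rankine-Hugoniot gives a right density `shockRight s` of order `s` and a left density `s ^ 2 *
shockRight s` of order `s ^ 3` (`wave₁_shock`). Let `s` oscillate like `e * (9 + 7 sin (1/e)) / 32`,
with `e` the truncated distance of `q` to 0. The left density is then Lipschitz in `e`
(`shockLeft_osc_lipschitz`), so the incoming 2-waves have finite variation, while the right density
has swings bounded below by a multiple of `1 / (n + 1)` (`rightDensity_oscPoint_gap`), and its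
variation diverges with the harmonic series.

Vacuum occurs only where `q = 0` meets the shock. Initially `p = q = x`, so the label `q = 0` lies
where the rarefaction has not yet lowered the density. The 2-waves with small `q > 0` cross the
shock just before `t₂`, which gives the blow-up. The compression later lifts the density above 1 and
leaves the transmitted 2-waves unchanged. Both the initial profile and the one at `t₃` on the
half-line thus stay in compact sets without vacuum, where weights lie between positive constants and
cannot change whether the variation is finite. -/

namespace PSystem

/-! ### Variation of real functions -/

section Variation

variable {α : Type*} [LinearOrder α]

theorem eVariationOn_le_add {f g h : α → ℝ} {s : Set α}
    (H : ∀ x ∈ s, ∀ y ∈ s, |h x - h y| ≤ |f x - f y| + |g x - g y|) :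
    eVariationOn h s ≤ eVariationOn f s + eVariationOn g s := by
  refine iSup_le fun ⟨n, u, hu, hs⟩ => ?_
  calc ∑ i ∈ Finset.range n, edist (h (u (i + 1))) (h (u i))
      ≤ ∑ i ∈ Finset.range n,
          (edist (f (u (i + 1))) (f (u i)) + edist (g (u (i + 1))) (g (u i))) := by
        refine Finset.sum_le_sum fun i _ => ?_
        rw [edist_dist, edist_dist, edist_dist, ← ENNReal.ofReal_add dist_nonneg dist_nonneg]
        exact ENNReal.ofReal_le_ofReal (H _ (hs _) _ (hs _))
    _ ≤ _ := by
        rw [Finset.sum_add_distrib]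
        exact add_le_add (eVariationOn.sum_le hu hs) (eVariationOn.sum_le hu hs)

theorem boundedVariationOn_of_abs_sub_le_add {f g h : α → ℝ} {s : Set α}
    (hf : BoundedVariationOn f s) (hg : BoundedVariationOn g s)
    (H : ∀ x ∈ s, ∀ y ∈ s, |h x - h y| ≤ |f x - f y| + |g x - g y|) :
    BoundedVariationOn h s :=
  ne_top_of_le_ne_top (ENNReal.add_ne_top.2 ⟨hf, hg⟩) (eVariationOn_le_add H)

theorem eVariationOn_le_of_monotone {f : α → ℝ} (hf : Monotone f) {a b : ℝ}
    (ha : ∀ x, a ≤ f x) (hb : ∀ x, f x ≤ b) :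
    eVariationOn f univ ≤ ENNReal.ofReal (b - a) := by
  rw [eVariationOn.eq_biSup_inter_Icc]
  refine iSup₂_le fun p _ => ?_
  rw [(hf.monotoneOn univ).eVariationOn_eq (mem_univ _) (mem_univ _)]
  exact ENNReal.ofReal_le_ofReal (by linarith [hb p.2, ha p.1])

theorem boundedVariationOn_of_monotone {f : α → ℝ} (hf : Monotone f) {a b : ℝ}
    (ha : ∀ x, a ≤ f x) (hb : ∀ x, f x ≤ b) : BoundedVariationOn f univ :=
  ne_top_of_le_ne_top ENNReal.ofReal_ne_top (eVariationOn_le_of_monotone hf ha hb)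

theorem boundedVariationOn_comp_add {f : ℝ → ℝ} (hf : BoundedVariationOn f univ) (a : ℝ) :
    BoundedVariationOn (fun x => f (x + a)) univ :=
  ne_top_of_le_ne_top hf (eVariationOn.comp_le_of_monotoneOn f (fun x => x + a)
    (fun _ _ _ _ h => by simpa using h) (mapsTo_univ _ _))

/-- The variation of `f` along a list of points. -/
noncomputable def listVariation (f : α → ℝ) : List α → ℝ≥0∞
  | x :: y :: l => edist (f x) (f y) + listVariation f (y :: l)
  | _ => 0

/-- Links `eVariationOn` to the recursive sums used for weights. The head is peeled off: the
variation over two ordered sets is the sum of both plus the gap between the greatest point of one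
and the least of the other. -/
theorem eVariationOn_list (f : α → ℝ) : ∀ l : List α, l.Pairwise (· ≤ ·) →
    eVariationOn f {z | z ∈ l} = listVariation f l
  | [], _ => by simp [listVariation]
  | [x], _ => by simp [listVariation]
  | x :: y :: l, h => by
    rw [listVariation, ← eVariationOn_list f (y :: l) (List.pairwise_cons.1 h).2]
    have e : {z | z ∈ x :: y :: l} = {x} ∪ {z | z ∈ y :: l} := by ext z; simp
    have hy : IsLeast {z | z ∈ y :: l} y := by
      refine ⟨by simp, fun z hz => ?_⟩
      rcases List.mem_cons.1 hz with rfl | hz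
      · exact le_rfl
      · exact (List.pairwise_cons.1 (List.pairwise_cons.1 h).2).1 z hz
    rw [e, eVariationOn.union' f isGreatest_singleton hy
      ((List.pairwise_cons.1 h).1 y (by simp))]
    simp

theorem exists_finset_lt_eVariationOn {f : α → ℝ} {s : Set α} {N : ℝ≥0∞}
    (h : N < eVariationOn f s) :
    ∃ F : Finset α, (F : Set α) ⊆ s ∧ N < eVariationOn f (F : Set α) := by
  classical
  obtain ⟨⟨n, u, hu, hs⟩, hN⟩ := lt_iSup_iff.1 h
  refine ⟨(Finset.range (n + 1)).image u, ?_, hN.trans_le ?_⟩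
  · intro z hz
    obtain ⟨i, -, rfl⟩ := Finset.mem_image.1 (Finset.mem_coe.1 hz)
    exact hs i
  · refine eVariationOn.sum_le_of_monotoneOn_Iic (hu.monotoneOn _) fun i hi => ?_
    exact Finset.mem_coe.2 (Finset.mem_image.2 ⟨i, by simpa using Nat.lt_succ_of_le hi, rfl⟩)

end Variation

/-! ### Weighted variation away from vacuum -/

section Weights

theorem map_sort_eq {S : Set ℝ} (F : Finset S) :
    (F.sort (· ≤ ·)).map (fun x => (x : ℝ)) = List.map Subtype.val (F.sort (· ≤ ·)) := by
  simp only [List.map_id', List.bind_eq_flatMap, List.pure_def]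
  exact List.map_eq_flatMap.symm

theorem pairwise_map_sort {S : Set ℝ} (F : Finset S) :
    ((F.sort (· ≤ ·)).map (fun x => (x : ℝ))).Pairwise (· ≤ ·) := by
  rw [map_sort_eq]
  exact List.pairwise_map.2 ((F.pairwise_sort (· ≤ ·)).imp fun h => h)

theorem mem_map_sort {S : Set ℝ} (F : Finset S) (z : ℝ) :
    z ∈ (F.sort (· ≤ ·)).map (fun x => (x : ℝ)) ↔ ∃ x ∈ F, (x : ℝ) = z := by
  rw [map_sort_eq]
  simp only [List.mem_map, Finset.mem_sort]

theorem weightedSum_le {W₁ W₂ : State × State → ℝ} {V : ℝ → State} {C : ℝ} (hC : 0 ≤ C) :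
    ∀ l : List ℝ, (∀ x ∈ l, ∀ y ∈ l, W₁ (V x, V y) ≤ C ∧ W₂ (V x, V y) ≤ C) →
    weightedSum W₁ W₂ V l ≤ ENNReal.ofReal C *
      (listVariation (fun x => w₁ (V x)) l + listVariation (fun x => w₂ (V x)) l)
  | [], _ => by simp [weightedSum]
  | [x], _ => by simp [weightedSum]
  | x :: y :: l, h => by
    rw [weightedSum, listVariation, listVariation]
    have ih := weightedSum_le hC (y :: l) fun a ha b hb =>
      h a (List.mem_cons_of_mem _ ha) b (List.mem_cons_of_mem _ hb)
    obtain ⟨h1, h2⟩ := h x (by simp) y (by simp)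
    have hstep : ENNReal.ofReal (W₁ (V x, V y) * |w₁ (V y) - w₁ (V x)| +
        W₂ (V x, V y) * |w₂ (V y) - w₂ (V x)|) ≤ ENNReal.ofReal C *
        (edist (w₁ (V x)) (w₁ (V y)) + edist (w₂ (V x)) (w₂ (V y))) := by
      rw [edist_comm, edist_comm (w₂ (V x)), edist_dist, edist_dist,
        ← ENNReal.ofReal_add dist_nonneg dist_nonneg, ← ENNReal.ofReal_mul hC, mul_add]
      exact ENNReal.ofReal_le_ofReal (add_le_add
        (mul_le_mul_of_nonneg_right h1 (abs_nonneg _))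
        (mul_le_mul_of_nonneg_right h2 (abs_nonneg _)))
    calc _ ≤ _ := add_le_add hstep ih
      _ = _ := by ring

/-- Since `ρ = (w₁ + w₂) / 2`, a change of density is controlled by the changes of the two
invariants. -/
theorem le_weightedSum {W₁ W₂ : State × State → ℝ} {V : ℝ → State} {m : ℝ} (hm : 0 ≤ m) :
    ∀ l : List ℝ, (∀ x ∈ l, ∀ y ∈ l, m ≤ W₁ (V x, V y) ∧ m ≤ W₂ (V x, V y)) →
    ENNReal.ofReal m * listVariation (fun x => (V x).2) l ≤ weightedSum W₁ W₂ V l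
  | [], _ => by simp [weightedSum, listVariation]
  | [x], _ => by simp [weightedSum, listVariation]
  | x :: y :: l, h => by
    rw [weightedSum, listVariation, mul_add]
    have ih := le_weightedSum hm (y :: l) fun a ha b hb =>
      h a (List.mem_cons_of_mem _ ha) b (List.mem_cons_of_mem _ hb)
    obtain ⟨h1, h2⟩ := h x (by simp) y (by simp)
    refine add_le_add ?_ ih
    rw [edist_comm, edist_dist, ← ENNReal.ofReal_mul hm, Real.dist_eq]
    refine ENNReal.ofReal_le_ofReal ?_
    have h3 : |(V y).2 - (V x).2| ≤ |w₁ (V y) - w₁ (V x)| + |w₂ (V y) - w₂ (V x)| := by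
      have e : (V y).2 - (V x).2 =
          ((w₁ (V y) - w₁ (V x)) + (w₂ (V y) - w₂ (V x))) / 2 := by simp only [w₁, w₂]; ring
      rw [e, abs_div, abs_two]
      linarith [abs_add_le (w₁ (V y) - w₁ (V x)) (w₂ (V y) - w₂ (V x)),
        abs_nonneg ((w₁ (V y) - w₁ (V x)) + (w₂ (V y) - w₂ (V x)))]
    calc m * |(V y).2 - (V x).2|
        ≤ m * |w₁ (V y) - w₁ (V x)| + m * |w₂ (V y) - w₂ (V x)| := by
          rw [← mul_add]; exact mul_le_mul_of_nonneg_left h3 hm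
      _ ≤ _ := add_le_add (mul_le_mul_of_nonneg_right h1 (abs_nonneg _))
          (mul_le_mul_of_nonneg_right h2 (abs_nonneg _))

/-- On a profile with values in a compact set without vacuum, weights are bounded above and
bounded away from zero. -/
theorem IsWeight.exists_bounds {W : State × State → ℝ} (hW : IsWeight W) {r M : ℝ} (hr : 0 < r) :
    ∃ m C : ℝ, 0 < m ∧ 0 ≤ C ∧ ∀ U V : State, |U.1| ≤ M → r ≤ U.2 → U.2 ≤ M →
      |V.1| ≤ M → r ≤ V.2 → V.2 ≤ M → m ≤ W (U, V) ∧ W (U, V) ≤ C := by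
  set K : Set State := Icc (-M) M ×ˢ Icc r M
  have hK : IsCompact (K ×ˢ K) :=
    (isCompact_Icc.prod isCompact_Icc).prod (isCompact_Icc.prod isCompact_Icc)
  have hpos : ∀ p ∈ K ×ˢ K, 0 < p.1.2 ∧ 0 < p.2.2 := fun p hp =>
    ⟨hr.trans_le hp.1.2.1, hr.trans_le hp.2.2.1⟩
  have hc : ContinuousOn W (K ×ˢ K) := hW.1.mono hpos
  have hmem : ∀ U V : State, |U.1| ≤ M → r ≤ U.2 → U.2 ≤ M →
      |V.1| ≤ M → r ≤ V.2 → V.2 ≤ M → (U, V) ∈ K ×ˢ K := fun U V a b c d e f =>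
    ⟨⟨abs_le.1 a, b, c⟩, ⟨abs_le.1 d, e, f⟩⟩
  rcases (K ×ˢ K).eq_empty_or_nonempty with h0 | hne
  · refine ⟨1, 0, one_pos, le_rfl, fun U V a b c d e f => ?_⟩
    have := hmem U V a b c d e f
    rw [h0] at this
    exact this.elim
  · obtain ⟨p, hp, hpm⟩ := hK.exists_isMinOn hne hc
    obtain ⟨q, hq, hqm⟩ := hK.exists_isMaxOn hne hc
    refine ⟨W p, W q, hW.2 p (hpos p hp).1 (hpos p hp).2,
      (hW.2 q (hpos q hq).1 (hpos q hq).2).le, fun U V a b c d e f => ?_⟩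
    exact ⟨hpm (hmem U V a b c d e f), hqm (hmem U V a b c d e f)⟩

theorem weightedVariation_lt_top {W₁ W₂ : State × State → ℝ} (h₁ : IsWeight W₁)
    (h₂ : IsWeight W₂) {V : ℝ → State} {S : Set ℝ} {r M : ℝ} (hr : 0 < r)
    (hV : ∀ x ∈ S, |(V x).1| ≤ M ∧ r ≤ (V x).2 ∧ (V x).2 ≤ M)
    (hv₁ : BoundedVariationOn (fun x => w₁ (V x)) S)
    (hv₂ : BoundedVariationOn (fun x => w₂ (V x)) S) :
    weightedVariation W₁ W₂ V S < ⊤ := by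
  obtain ⟨m₁, C₁, -, hC₁, H₁⟩ := h₁.exists_bounds (M := M) hr
  obtain ⟨m₂, C₂, -, hC₂, H₂⟩ := h₂.exists_bounds (M := M) hr
  have hbound : weightedVariation W₁ W₂ V S ≤ ENNReal.ofReal (C₁ + C₂) *
      (eVariationOn (fun x => w₁ (V x)) S + eVariationOn (fun x => w₂ (V x)) S) := by
    refine limsup_le_of_le (by isBoundedDefault) (Eventually.of_forall fun F => ?_)
    set l := (F.sort (· ≤ ·)).map (fun x => (x : ℝ)) with hl
    have hlS : {z | z ∈ l} ⊆ S := fun z hz => by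
      obtain ⟨x, -, rfl⟩ := (mem_map_sort F z).1 hz
      exact x.2
    refine (weightedSum_le (C := C₁ + C₂) (by positivity) l fun x hx y hy => ?_).trans ?_
    · obtain ⟨a, b, c⟩ := hV x (hlS hx)
      obtain ⟨d, e, f⟩ := hV y (hlS hy)
      have h3 := (H₁ (V x) (V y) a b c d e f).2
      have h4 := (H₂ (V x) (V y) a b c d e f).2
      constructor <;> linarith
    · rw [← eVariationOn_list _ l (pairwise_map_sort F),
        ← eVariationOn_list _ l (pairwise_map_sort F)]
      gcongr
      · exact eVariationOn.mono _ hlS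
      · exact eVariationOn.mono _ hlS
  exact hbound.trans_lt (ENNReal.mul_lt_top ENNReal.ofReal_lt_top
    (ENNReal.add_lt_top.2 ⟨hv₁.lt_top, hv₂.lt_top⟩))

theorem weightedVariation_eq_top {W₁ W₂ : State × State → ℝ} (h₁ : IsWeight W₁)
    (h₂ : IsWeight W₂) {V : ℝ → State} {S : Set ℝ} {r M : ℝ} (hr : 0 < r)
    (hV : ∀ x ∈ S, |(V x).1| ≤ M ∧ r ≤ (V x).2 ∧ (V x).2 ≤ M)
    (hv : eVariationOn (fun x => (V x).2) S = ⊤) :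
    weightedVariation W₁ W₂ V S = ⊤ := by
  classical
  obtain ⟨m₁, C₁, hm₁, -, H₁⟩ := h₁.exists_bounds (M := M) hr
  obtain ⟨m₂, C₂, hm₂, -, H₂⟩ := h₂.exists_bounds (M := M) hr
  set m := min m₁ m₂
  have hm : 0 < m := lt_min hm₁ hm₂
  have hlow : ∀ N : ℝ≥0∞, N < ⊤ → ENNReal.ofReal m * N ≤ weightedVariation W₁ W₂ V S := by
    intro N hN
    refine le_limsup_of_frequently_le (frequently_atTop.2 fun F₀ => ?_) (by isBoundedDefault)
    obtain ⟨G, hGS, hG⟩ := exists_finset_lt_eVariationOn (hN.trans_eq hv.symm)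
    -- Adjoining points to `G` only increases the unweighted variation, so large sums occur beyond
    -- every `F₀`.
    refine ⟨F₀ ∪ G.subtype (· ∈ S), Finset.subset_union_left, ?_⟩
    set F : Finset S := F₀ ∪ G.subtype (· ∈ S) with hF
    set l := (F.sort (· ≤ ·)).map (fun x => (x : ℝ)) with hl
    have hlS : {z | z ∈ l} ⊆ S := fun z hz => by
      obtain ⟨x, -, rfl⟩ := (mem_map_sort F z).1 hz
      exact x.2
    have hGl : (G : Set ℝ) ⊆ {z | z ∈ l} := fun z hz =>
      (mem_map_sort F z).2 ⟨⟨z, hGS hz⟩, Finset.mem_union_right _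
        (Finset.mem_subtype.2 hz), rfl⟩
    refine le_trans ?_ (le_weightedSum hm.le l fun x hx y hy => ?_)
    · rw [← eVariationOn_list _ l (pairwise_map_sort F)]
      gcongr
      exact hG.le.trans (eVariationOn.mono _ hGl)
    · obtain ⟨a, b, c⟩ := hV x (hlS hx)
      obtain ⟨d, e, f⟩ := hV y (hlS hy)
      exact ⟨(min_le_left _ _).trans (H₁ (V x) (V y) a b c d e f).1,
        (min_le_right _ _).trans (H₂ (V x) (V y) a b c d e f).1⟩
  by_contra hne
  set T := weightedVariation W₁ W₂ V S
  have hm0 : ENNReal.ofReal m ≠ 0 := by simpa using hm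
  -- With this choice of `N`, `hlow` would give `T + 1 ≤ T` for a finite `T`.
  have hlt : (T + 1) / ENNReal.ofReal m < ⊤ :=
    ENNReal.div_lt_top (ENNReal.add_ne_top.2 ⟨hne, ENNReal.one_ne_top⟩) hm0
  have := hlow _ hlt
  rw [ENNReal.mul_div_cancel hm0 ENNReal.ofReal_ne_top] at this
  exact absurd this (not_le.2 (ENNReal.lt_add_right hne one_ne_zero))

end Weights

/-! ### Shock densities, the oscillation and the cutoffs -/

/-- The density on the right of a 1-shock across which `w₁` increases by `1`, the ratio of the
densities being `s ^ 2`. -/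
noncomputable def shockRight (s : ℝ) : ℝ := s / ((1 - s ^ 2) * (s + √((1 + s ^ 2 + s ^ 4) / 3)))

/-- The density on the left of this shock. -/
noncomputable def shockLeft (s : ℝ) : ℝ := s ^ 2 * shockRight s

/-- An oscillation of infinite variation near `0`. -/
noncomputable def osc (e : ℝ) : ℝ := e * (9 + 7 * Real.sin e⁻¹) / 32

noncomputable def clamp (x : ℝ) : ℝ := max 0 (min x 1)

/-- The distance to the origin, truncated at `1`. -/
noncomputable def truncAbs (y : ℝ) : ℝ := min |y| 1

theorem clamp_mono : Monotone clamp := fun _ _ h => max_le_max le_rfl (min_le_min h le_rfl)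

theorem clamp_nonneg (x : ℝ) : 0 ≤ clamp x := le_max_left _ _

theorem clamp_le_one (x : ℝ) : clamp x ≤ 1 := max_le zero_le_one (min_le_right _ _)

theorem clamp_of_nonpos {x : ℝ} (h : x ≤ 0) : clamp x = 0 :=
  max_eq_left ((min_le_left _ _).trans h)

theorem clamp_of_one_le {x : ℝ} (h : 1 ≤ x) : clamp x = 1 := by
  rw [clamp, min_eq_right h, max_eq_right zero_le_one]

theorem clamp_pos {x : ℝ} (h : 0 < x) : 0 < clamp x := lt_max_of_lt_right (lt_min h one_pos)

theorem clamp_le_max {x : ℝ} : clamp x ≤ max 0 x := max_le_max le_rfl (min_le_left _ _)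

theorem continuous_clamp : Continuous clamp := by unfold clamp; fun_prop

theorem boundedVariationOn_clamp : BoundedVariationOn clamp univ :=
  boundedVariationOn_of_monotone clamp_mono clamp_nonneg clamp_le_one

theorem truncAbs_nonneg (y : ℝ) : 0 ≤ truncAbs y := le_min (abs_nonneg _) zero_le_one

theorem truncAbs_le_one (y : ℝ) : truncAbs y ≤ 1 := min_le_right _ _

theorem truncAbs_pos {y : ℝ} (h : y ≠ 0) : 0 < truncAbs y := lt_min (abs_pos.2 h) one_pos

theorem truncAbs_of_mem {y : ℝ} (h0 : 0 ≤ y) (h1 : y ≤ 1) : truncAbs y = y := by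
  rw [truncAbs, abs_of_nonneg h0, min_eq_left h1]

theorem continuous_truncAbs : Continuous truncAbs := by unfold truncAbs; fun_prop

theorem truncAbs_eq (y : ℝ) : truncAbs y = clamp y + clamp (-y) := by
  rcases le_total 0 y with h | h
  · rw [clamp_of_nonpos (x := -y) (by linarith), add_zero, truncAbs, abs_of_nonneg h, clamp,
      max_eq_right (le_min h zero_le_one)]
  · rw [clamp_of_nonpos h, zero_add, truncAbs, abs_of_nonpos h, clamp,
      max_eq_right (le_min (by linarith) zero_le_one)]

theorem boundedVariationOn_truncAbs : BoundedVariationOn truncAbs univ := by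
  have h : BoundedVariationOn (fun y => -clamp (-y)) univ :=
    boundedVariationOn_of_monotone (a := -1) (b := 0)
      (fun _ _ h => neg_le_neg (clamp_mono (neg_le_neg h)))
      (fun y => neg_le_neg (clamp_le_one _)) (fun y => neg_nonpos.2 (clamp_nonneg _))
  refine boundedVariationOn_of_abs_sub_le_add boundedVariationOn_clamp h fun x _ y _ => ?_
  rw [truncAbs_eq, truncAbs_eq, show clamp x + clamp (-x) - (clamp y + clamp (-y)) =
    (clamp x - clamp y) - (-clamp (-x) - -clamp (-y)) by ring]
  exact abs_sub _ _

theorem osc_le {e : ℝ} (h : 0 ≤ e) : osc e ≤ e / 2 := by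
  rw [osc]; nlinarith [Real.sin_le_one e⁻¹]

theorem le_osc {e : ℝ} (h : 0 ≤ e) : e / 16 ≤ osc e := by
  rw [osc]; nlinarith [Real.neg_one_le_sin e⁻¹]

theorem osc_mem {e : ℝ} (h0 : 0 ≤ e) (h1 : e ≤ 1) : osc e ∈ Icc (0 : ℝ) (1 / 2) :=
  ⟨by linarith [le_osc h0], by linarith [osc_le h0]⟩

theorem continuous_osc : Continuous osc := by
  refine continuous_iff_continuousAt.2 fun e => ?_
  rcases eq_or_ne e 0 with rfl | he
  · have h0 : osc 0 = 0 := by simp [osc]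
    rw [ContinuousAt, h0]
    refine squeeze_zero_norm (a := fun e => |e|) (fun e => ?_) ?_
    · rw [osc, Real.norm_eq_abs, abs_div, abs_mul]
      have : |9 + 7 * Real.sin e⁻¹| ≤ 16 := by
        rw [abs_le]; constructor <;> linarith [Real.sin_le_one e⁻¹, Real.neg_one_le_sin e⁻¹]
      rw [abs_of_pos (show (0 : ℝ) < 32 by norm_num)]
      nlinarith [abs_nonneg e]
    · simpa using continuous_abs.tendsto (0 : ℝ)
  · unfold osc
    fun_prop (disch := assumption)

/-- The slope of `osc` at `e` may be of order `1 / e`; one extra factor `f` compensates, because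
`sin (1/e) - sin (1/f)` is at most `(f - e) / (e f)`. -/
theorem abs_osc_sub_mul_le {e f : ℝ} (he : 0 ≤ e) (hef : e ≤ f) (hf : f ≤ 1) :
    |osc e - osc f| * f ≤ f - e := by
  rcases he.eq_or_lt with rfl | he
  · have h1 := osc_le hef
    have h2 := le_osc hef
    have h0 : osc 0 = 0 := by simp [osc]
    rw [h0, zero_sub, abs_neg, abs_of_nonneg (by linarith)]
    nlinarith
  have hf0 : 0 < f := he.trans_le hef
  have hs : e * |Real.sin e⁻¹ - Real.sin f⁻¹| * f ≤ f - e := by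
    have h := Real.abs_sin_sub_sin_le e⁻¹ f⁻¹
    have h2 : |e⁻¹ - f⁻¹| = (f - e) / (e * f) := by
      rw [abs_of_nonneg (sub_nonneg.2 (inv_anti₀ he hef))]; field_simp
    rw [h2, le_div_iff₀ (by positivity)] at h
    linarith
  have e1 : osc e - osc f = 9 / 32 * (e - f) + 7 / 32 * ((e - f) * Real.sin f⁻¹) +
      7 / 32 * (e * (Real.sin e⁻¹ - Real.sin f⁻¹)) := by simp only [osc]; ring
  have h3 : |(e - f) * Real.sin f⁻¹| ≤ f - e := by
    rw [abs_mul, abs_of_nonpos (by linarith : e - f ≤ 0)]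
    nlinarith [Real.abs_sin_le_one f⁻¹]
  have h4 : |osc e - osc f| ≤ 9 / 32 * (f - e) + 7 / 32 * (f - e) +
      7 / 32 * (e * |Real.sin e⁻¹ - Real.sin f⁻¹|) := by
    rw [e1]
    refine (abs_add_three _ _ _).trans ?_
    rw [abs_mul, abs_mul (7 / 32), abs_mul (7 / 32), abs_mul e, abs_of_pos he,
      abs_of_nonpos (by linarith : e - f ≤ 0), abs_of_pos (show (0 : ℝ) < 9 / 32 by norm_num),
      abs_of_pos (show (0 : ℝ) < 7 / 32 by norm_num)]
    linarith
  nlinarith [mul_le_mul_of_nonneg_right h4 hf0.le]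

/-! ### The Rankine-Hugoniot curve -/

theorem shockRight_denom_bounds {s : ℝ} (h : s ∈ Icc (0 : ℝ) (1 / 2)) :
    2 / 5 ≤ (1 - s ^ 2) * (s + √((1 + s ^ 2 + s ^ 4) / 3)) ∧
      (1 - s ^ 2) * (s + √((1 + s ^ 2 + s ^ 4) / 3)) ≤ 5 / 4 := by
  obtain ⟨h0, h1⟩ := h
  have h2 : s ^ 2 ≤ 1 / 4 := by nlinarith
  have h4 : s ^ 4 ≤ 1 / 16 := by nlinarith [sq_nonneg s]
  have a : 8 / 15 ≤ √((1 + s ^ 2 + s ^ 4) / 3) := by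
    apply Real.le_sqrt_of_sq_le; nlinarith [sq_nonneg s, sq_nonneg (s ^ 2)]
  have b : √((1 + s ^ 2 + s ^ 4) / 3) ≤ 3 / 4 := by
    rw [Real.sqrt_le_left (by norm_num)]; linarith
  constructor
  · nlinarith
  · nlinarith [sq_nonneg s]

theorem le_shockRight {s : ℝ} (h : s ∈ Icc (0 : ℝ) (1 / 2)) : 4 / 5 * s ≤ shockRight s := by
  obtain ⟨h1, h2⟩ := shockRight_denom_bounds h
  rw [shockRight, le_div_iff₀ (by linarith)]
  nlinarith [h.1]

theorem shockRight_le {s : ℝ} (h : s ∈ Icc (0 : ℝ) (1 / 2)) : shockRight s ≤ 5 / 2 * s := by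
  obtain ⟨h1, h2⟩ := shockRight_denom_bounds h
  rw [shockRight, div_le_iff₀ (by linarith)]
  nlinarith [h.1]

theorem shockRight_lipschitz : ∃ K, LipschitzOnWith K shockRight (Icc 0 (1 / 2)) := by
  refine ContDiffOn.exists_lipschitzOnWith (n := 1) ?_ one_ne_zero (convex_Icc _ _) isCompact_Icc
  unfold shockRight
  refine contDiffOn_id.div ?_ fun s hs => by linarith [(shockRight_denom_bounds hs).1]
  refine ContDiffOn.mul (by fun_prop) (contDiffOn_id.add (ContDiffOn.sqrt (by fun_prop) ?_))
  intro s _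
  positivity

/-- The two states are joined by an admissible 1-shock. -/
theorem wave₁_shock {s : ℝ} (h0 : 0 < s) (h1 : s ≤ 1 / 2) :
    Wave₁ (shockLeft s, shockLeft s) (shockRight s - 1, shockRight s) := by
  set B := shockRight s with hB
  have hBpos : 0 < B := by linarith [le_shockRight ⟨h0.le, h1⟩]
  have hA : shockLeft s = s ^ 2 * B := rfl
  set Q := √((1 + s ^ 2 + s ^ 4) / 3) with hQ
  have hQ2 : Q ^ 2 = (1 + s ^ 2 + s ^ 4) / 3 := Real.sq_sqrt (by positivity)
  have hQpos : 0 < Q := Real.sqrt_pos.2 (by positivity)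
  have hs2 : s ^ 2 ≤ 1 / 4 := by nlinarith
  have hD : 0 < (1 - s ^ 2) * (s + Q) := mul_pos (by linarith) (by linarith)
  -- Eliminating the speed gives (velocity drop)² = (pressure jump)(drop of `v`). With ratio `s ^ 2`
  -- the right side is a square apart from `Q ^ 2`; taking the root leaves a linear equation for
  -- `B`, and this is its solution.
  have hrel : B * ((1 - s ^ 2) * (s + Q)) = s := by
    rw [hB, shockRight, ← hQ, div_mul_cancel₀ _ hD.ne']
  have hphi : (s ^ 2 * B - (B - 1)) * s = B * (1 - s ^ 2) * Q := by linear_combination -hrel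
  have hphipos : 0 < s ^ 2 * B - (B - 1) := by
    have : 0 < B * (1 - s ^ 2) * Q := mul_pos (mul_pos hBpos (by linarith)) hQpos
    rw [← hphi] at this
    exact pos_of_mul_pos_left this h0.le
  have hv : 1 / B - 1 / (s ^ 2 * B) = -((1 - s ^ 2) / (s ^ 2 * B)) := by
    field_simp; ring
  have hvpos : 0 < (1 - s ^ 2) / (s ^ 2 * B) := div_pos (by linarith) (by positivity)
  refine ⟨by rw [hA]; positivity, hBpos, Or.inr ⟨?_, ?_⟩⟩
  · show shockLeft s < B
    rw [hA]; nlinarith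
  · refine ⟨-((s ^ 2 * B - (B - 1)) / ((1 - s ^ 2) / (s ^ 2 * B))),
      neg_neg_of_pos (div_pos hphipos hvpos), ?_, ?_⟩
    · show _ * (1 / B - 1 / shockLeft s) = shockLeft s - (B - 1)
      rw [hA, hv, neg_mul_neg, div_mul_cancel₀ _ hvpos.ne']
    · show _ * (B - 1 - shockLeft s) = B ^ 3 / 3 - shockLeft s ^ 3 / 3
      have h1s : 1 - s ^ 2 ≠ 0 := by linarith
      -- The speed was chosen to solve the first equation; this identity is what the second one then
      -- requires.
      have key : (s ^ 2 * B - (B - 1)) ^ 2 * s ^ 2 =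
          (1 - s ^ 2) * (B ^ 2 - s ^ 6 * B ^ 2) / 3 := by
        rw [← mul_pow, hphi, mul_pow, hQ2]; ring
      rw [hA]
      set φ := s ^ 2 * B - (B - 1) with hφ
      have e : B - 1 - s ^ 2 * B = -φ := by rw [hφ]; ring
      rw [e, neg_mul_neg, div_mul_eq_mul_div, div_eq_iff hvpos.ne', mul_div_assoc',
        eq_div_iff (by positivity)]
      linear_combination B * key

/-! ### Densities beside the shock as functions of the 2-label -/

/-- The parameter of the shock when it meets the 2-wave issued from `y`. -/
noncomputable def shockParam (y : ℝ) : ℝ := osc (truncAbs y)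

theorem shockParam_mem (y : ℝ) : shockParam y ∈ Icc (0 : ℝ) (1 / 2) :=
  osc_mem (truncAbs_nonneg y) (truncAbs_le_one y)

theorem shockParam_pos {y : ℝ} (h : y ≠ 0) : 0 < shockParam y := by
  have := truncAbs_pos h
  linarith [le_osc this.le, show shockParam y = osc (truncAbs y) from rfl]

theorem continuous_shockParam : Continuous shockParam := continuous_osc.comp continuous_truncAbs

/-- The density on the left of the shock as a function of the label of the 2-wave. -/
noncomputable def leftDensity (y : ℝ) : ℝ := shockLeft (shockParam y)

/-- The density on the right of the shock as a function of the label of the 2-wave. -/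
noncomputable def rightDensity (y : ℝ) : ℝ := shockRight (shockParam y)

theorem rightDensity_nonneg (y : ℝ) : 0 ≤ rightDensity y := by
  have := le_shockRight (shockParam_mem y)
  have := (shockParam_mem y).1
  unfold rightDensity; linarith

theorem rightDensity_le (y : ℝ) : rightDensity y ≤ 5 / 4 := by
  have := shockRight_le (shockParam_mem y)
  have := (shockParam_mem y).2
  unfold rightDensity; linarith

theorem rightDensity_pos {y : ℝ} (h : y ≠ 0) : 0 < rightDensity y := by
  have := le_shockRight (shockParam_mem y)
  have := shockParam_pos h
  unfold rightDensity; linarith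

theorem leftDensity_nonneg (y : ℝ) : 0 ≤ leftDensity y :=
  mul_nonneg (sq_nonneg _) (rightDensity_nonneg y)

theorem leftDensity_le (y : ℝ) : leftDensity y ≤ 1 := by
  obtain ⟨h0, h1⟩ := shockParam_mem y
  have h2 : shockParam y ^ 2 ≤ 1 / 4 := by nlinarith
  have := mul_le_mul h2 (rightDensity_le y) (rightDensity_nonneg y) (by norm_num)
  have e : leftDensity y = shockParam y ^ 2 * rightDensity y := rfl
  rw [e]; linarith

theorem rightDensity_ge_of_half_le {y : ℝ} (h : 1 / 2 ≤ y) : 1 / 40 ≤ rightDensity y := by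
  have h1 : 1 / 2 ≤ truncAbs y :=
    le_min (h.trans (le_abs_self y)) (by norm_num)
  have h2 := le_osc (by linarith : 0 ≤ truncAbs y)
  have := le_shockRight (shockParam_mem y)
  have e : shockParam y = osc (truncAbs y) := rfl
  unfold rightDensity; linarith

theorem leftDensity_ge_of_half_le {y : ℝ} (h : 1 / 2 ≤ y) : 1 / 40960 ≤ leftDensity y := by
  have h1 : 1 / 2 ≤ truncAbs y :=
    le_min (h.trans (le_abs_self y)) (by norm_num)
  have h2 := le_osc (by linarith : 0 ≤ truncAbs y)
  have h3 : 1 / 32 ≤ shockParam y := by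
    have e : shockParam y = osc (truncAbs y) := rfl
    linarith
  have h4 : 1 / 1024 ≤ shockParam y ^ 2 := by nlinarith
  have e : leftDensity y = shockParam y ^ 2 * rightDensity y := rfl
  rw [e]
  nlinarith [rightDensity_ge_of_half_le h]

theorem continuous_rightDensity : Continuous rightDensity := by
  obtain ⟨K, hK⟩ := shockRight_lipschitz
  exact hK.continuousOn.comp_continuous continuous_shockParam shockParam_mem

theorem continuous_leftDensity : Continuous leftDensity :=
  (continuous_shockParam.pow 2).mul continuous_rightDensity

/-- Here the incoming 2-waves get finite variation: the prefactor `s ^ 2` supplies the factor `f`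
that tames `osc` in `abs_osc_sub_mul_le`. -/
theorem shockLeft_osc_lipschitz :
    ∃ K, LipschitzOnWith K (fun e => shockLeft (osc e)) (Icc 0 1) := by
  obtain ⟨K, hK⟩ := shockRight_lipschitz
  refine ⟨K + 5, ?_⟩
  have main : ∀ e f : ℝ, 0 ≤ e → e ≤ f → f ≤ 1 →
      |shockLeft (osc e) - shockLeft (osc f)| ≤ (K + 5) * |e - f| := by
    intro e f he hef hf
    have h := abs_osc_sub_mul_le he hef hf
    have hf0 := he.trans hef
    have hse := osc_mem he (hef.trans hf)
    have hsf := osc_mem hf0 hf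
    have hsef : osc e ≤ f / 2 := (osc_le he).trans (by linarith)
    have hsff : osc f ≤ f / 2 := osc_le hf0
    set s := osc e
    set t := osc f
    have h1 : |shockRight s - shockRight t| ≤ K * |s - t| := by
      simpa [Real.dist_eq] using hK.dist_le_mul s hse t hsf
    -- Both terms contain a difference bounded by a multiple of `|s - t|`, times a coefficient that
    -- is `O(f)`.
    have e1 : shockLeft s - shockLeft t =
        (s - t) * ((s + t) * shockRight s) + t ^ 2 * (shockRight s - shockRight t) := by
      simp only [shockLeft]; ring
    have hs0 : 0 ≤ shockRight s := by linarith [le_shockRight hse, hse.1]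
    have hs1 : shockRight s ≤ 5 / 4 := by linarith [shockRight_le hse, hse.2]
    have h2 : (s + t) * shockRight s ≤ 5 * f := by
      have : (s + t) * shockRight s ≤ f * (5 / 4) :=
        mul_le_mul (by linarith) hs1 hs0 hf0
      linarith
    have h3 : t ^ 2 ≤ f := by nlinarith [hsf.1, hsf.2]
    have hst := abs_nonneg (s - t)
    calc |shockLeft s - shockLeft t|
        ≤ |s - t| * ((s + t) * shockRight s) + t ^ 2 * |shockRight s - shockRight t| := by
          rw [e1]
          refine (abs_add_le _ _).trans_eq ?_
          rw [abs_mul, abs_mul (t ^ 2), abs_of_nonneg (sq_nonneg t),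
            abs_of_nonneg (mul_nonneg (add_nonneg hse.1 hsf.1) hs0)]
      _ ≤ |s - t| * (5 * f) + f * (K * |s - t|) := by
          gcongr
      _ = (K + 5) * (|s - t| * f) := by ring
      _ ≤ (K + 5) * |e - f| := by
          rw [abs_of_nonpos (by linarith : e - f ≤ 0)]
          have : (0 : ℝ) ≤ K + 5 := by positivity
          gcongr
          linarith
  refine LipschitzOnWith.of_dist_le_mul fun e he f hf => ?_
  rw [Real.dist_eq, Real.dist_eq]
  push_cast
  rcases le_total e f with h | h
  · exact main e f he.1 h hf.2
  · rw [abs_sub_comm, abs_sub_comm e]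
    exact main f e hf.1 h he.2

theorem boundedVariationOn_leftDensity : BoundedVariationOn leftDensity univ := by
  obtain ⟨K, hK⟩ := shockLeft_osc_lipschitz
  exact hK.comp_boundedVariationOn (fun y _ => ⟨truncAbs_nonneg y, truncAbs_le_one y⟩)
    boundedVariationOn_truncAbs

theorem shockRight_osc_lipschitz {η : ℝ} (hη : 0 < η) :
    ∃ K, LipschitzOnWith K (fun e => shockRight (osc e)) (Icc η 1) := by
  obtain ⟨K, hK⟩ := shockRight_lipschitz
  have hosc : LipschitzOnWith (η⁻¹).toNNReal osc (Icc η 1) := by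
    have main : ∀ e f : ℝ, η ≤ e → e ≤ f → f ≤ 1 → |osc e - osc f| ≤ η⁻¹ * |e - f| := by
      intro e f he hef hf
      have h := abs_osc_sub_mul_le (hη.le.trans he) hef hf
      rw [abs_of_nonpos (by linarith : e - f ≤ 0), ← div_eq_inv_mul, le_div_iff₀ hη]
      nlinarith [abs_nonneg (osc e - osc f)]
    refine LipschitzOnWith.of_dist_le_mul fun e he f hf => ?_
    rw [Real.dist_eq, Real.dist_eq, Real.coe_toNNReal _ (inv_nonneg.2 hη.le)]
    rcases le_total e f with h | h
    · exact main e f he.1 h hf.2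
    · rw [abs_sub_comm, abs_sub_comm e]
      exact main f e hf.1 h he.2
  exact ⟨_, hK.comp hosc fun e he => osc_mem (hη.le.trans he.1) he.2⟩

theorem boundedVariationOn_rightDensity_max {η : ℝ} (h0 : 0 < η) (h1 : η ≤ 1) :
    BoundedVariationOn (fun y => rightDensity (max y η)) univ := by
  obtain ⟨K, hK⟩ := shockRight_osc_lipschitz h0
  have hv : BoundedVariationOn (fun y => truncAbs (max y η)) univ :=
    ne_top_of_le_ne_top boundedVariationOn_truncAbs
      (eVariationOn.comp_le_of_monotoneOn truncAbs (fun y => max y η)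
        (fun _ _ _ _ h => max_le_max h le_rfl) (mapsTo_univ _ _))
  refine hK.comp_boundedVariationOn (fun y _ => ⟨?_, truncAbs_le_one _⟩) hv
  exact le_min ((le_max_right y η).trans (le_abs_self _)) h1

/-! ### Infinite variation of the transmitted 2-waves -/

/-- The points where the oscillation reaches its extremal values. -/
noncomputable def oscPoint (k : ℕ) : ℝ := (Real.pi / 2 + k * Real.pi)⁻¹

theorem oscPoint_pos (k : ℕ) : 0 < oscPoint k := by
  have := Real.pi_pos
  unfold oscPoint; positivity

theorem oscPoint_anti : Antitone oscPoint := fun i j h => by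
  have := Real.pi_pos
  unfold oscPoint; gcongr

theorem oscPoint_le_one (k : ℕ) : oscPoint k ≤ 1 := by
  refine inv_le_one_of_one_le₀ ?_
  have := Real.pi_gt_three
  have : (0 : ℝ) ≤ k * Real.pi := by positivity
  linarith

theorem sin_inv_oscPoint (k : ℕ) : Real.sin (oscPoint k)⁻¹ = (-1) ^ k := by
  rw [oscPoint, inv_inv, Real.sin_add_nat_mul_pi, Real.sin_pi_div_two, mul_one]

theorem shockParam_oscPoint (k : ℕ) :
    shockParam (oscPoint k) = oscPoint k * (9 + 7 * (-1) ^ k) / 32 := by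
  rw [shockParam, truncAbs_of_mem (oscPoint_pos k).le (oscPoint_le_one k), osc, sin_inv_oscPoint]

/-- The parameter is `e / 2` at even points and `e / 16` at odd ones. This factor 8 beats the ratio
25/8 of the linear bounds `5/2 * s` and `4/5 * s`, so monotonicity of `shockRight` is not needed. -/
theorem rightDensity_oscPoint_gap (n : ℕ) :
    ENNReal.ofReal (1 / 40 * (1 / (n + 1))) ≤
      edist (rightDensity (oscPoint (2 * n + 1))) (rightDensity (oscPoint (2 * n))) := by
  have h1 := le_shockRight (shockParam_mem (oscPoint (2 * n)))
  have h2 := shockRight_le (shockParam_mem (oscPoint (2 * n + 1)))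
  rw [shockParam_oscPoint, pow_mul, neg_one_sq, one_pow] at h1
  rw [shockParam_oscPoint, pow_succ, pow_mul, neg_one_sq, one_pow] at h2
  have h3 : oscPoint (2 * n + 1) ≤ oscPoint (2 * n) := oscPoint_anti (Nat.le_succ _)
  have h4 : 1 / 8 * (1 / ((n : ℝ) + 1)) ≤ oscPoint (2 * n) := by
    have hpi := Real.pi_le_four
    have hpi0 := Real.pi_pos
    rw [oscPoint, one_div, one_div, ← mul_inv]
    refine inv_anti₀ (by positivity) ?_
    push_cast
    have : (n : ℝ) * Real.pi ≤ n * 4 := by gcongr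
    linarith
  rw [edist_dist, Real.dist_eq, abs_sub_comm]
  refine ENNReal.ofReal_le_ofReal (le_trans ?_ (le_abs_self _))
  unfold rightDensity
  rw [shockParam_oscPoint, shockParam_oscPoint, pow_succ, pow_mul, neg_one_sq, one_pow]
  have h5 : 0 ≤ 1 / ((n : ℝ) + 1) := by positivity
  linarith

/-- Only the swing inside each pair of consecutive points `2 n + 1`, `2 n` is counted; these pairs
are ordered towards 0. -/
theorem sum_le_eVariationOn_rightDensity (n : ℕ) :
    ∑ i ∈ Finset.range n, ENNReal.ofReal (1 / 40 * (1 / ((i : ℝ) + 1))) ≤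
      eVariationOn rightDensity (Ici (oscPoint (2 * n))) := by
  induction n with
  | zero => simp
  | succ n ih =>
    rw [Finset.sum_range_succ, add_comm]
    calc _ ≤ eVariationOn rightDensity {oscPoint (2 * n + 1), oscPoint (2 * n)} +
          eVariationOn rightDensity (Ici (oscPoint (2 * n))) := by
          rw [eVariationOn.pair]
          exact add_le_add (rightDensity_oscPoint_gap n) ih
      _ ≤ _ := eVariationOn.add_le_union _ fun x hx y hy => ?_
      _ ≤ _ := eVariationOn.mono _ ?_
    · rcases hx with rfl | rfl
      · exact (oscPoint_anti (Nat.le_succ _)).trans hy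
      · exact hy
    · rintro z ((rfl | rfl) | hz)
      · exact oscPoint_anti (by omega)
      · exact oscPoint_anti (by omega)
      · exact (oscPoint_anti (by omega)).trans hz

theorem exists_lt_eVariationOn_rightDensity {N : ℝ≥0∞} (hN : N ≠ ⊤) :
    ∃ η > 0, N < eVariationOn rightDensity (Ici η) := by
  obtain ⟨n, hn⟩ := ((tendsto_atTop.1 Real.tendsto_sum_range_one_div_nat_succ_atTop
    (40 * (N.toReal + 1))).exists)
  refine ⟨oscPoint (2 * n), oscPoint_pos _, lt_of_lt_of_le ?_
    (sum_le_eVariationOn_rightDensity n)⟩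
  rw [← ENNReal.ofReal_sum_of_nonneg fun i _ => by positivity, ← Finset.mul_sum,
    ENNReal.lt_ofReal_iff_toReal_lt hN]
  linarith

theorem tendsto_eVariationOn_rightDensity :
    Tendsto (fun η => eVariationOn rightDensity (Ici η)) (𝓝[>] 0) (𝓝 ⊤) := by
  refine ENNReal.tendsto_nhds_top_iff_nnreal.2 fun N => ?_
  obtain ⟨η, hη, h⟩ := exists_lt_eVariationOn_rightDensity (N := N) ENNReal.coe_ne_top
  filter_upwards [Ioo_mem_nhdsGT hη] with ξ hξ
  exact h.trans_le (eVariationOn.mono _ (Ici_subset_Ici.2 hξ.2.le))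

theorem eVariationOn_rightDensity_Ioi : eVariationOn rightDensity (Ioi 0) = ⊤ := by
  by_contra hne
  obtain ⟨η, hη, h⟩ := exists_lt_eVariationOn_rightDensity hne
  exact absurd h (not_lt.2 (eVariationOn.mono _ fun z hz => hη.trans_le hz))

/-! ### The solution in the labels `p`, `q` -/

/-- The state on the left of the shock, where the 1-wave `p` meets the 2-wave `q`. -/
noncomputable def stateLeft (p q : ℝ) : State :=
  (leftDensity q - (1 - clamp p) / 2, leftDensity q + (1 - clamp p) / 2)

/-- The state on the right of the shock, where the 1-wave `p` meets the 2-wave `q`. -/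
noncomputable def stateRight (p q : ℝ) : State :=
  (rightDensity q - 1 - clamp (p - 1), rightDensity q + clamp (p - 1))

/-- The state at the point where the 1-wave `p` meets the 2-wave `q`. -/
noncomputable def crossing (p q : ℝ) : State :=
  if p < 1 then stateLeft p q else stateRight p q

/-- A front tracking solution with a single jump front, the 1-shock `x = 1 - c t`. -/
noncomputable def solution (c t x : ℝ) : State := crossing (x + c * t) (x - c * t)

theorem continuous_stateLeft : Continuous fun z : ℝ × ℝ => stateLeft z.1 z.2 := by
  have := continuous_leftDensity
  have := continuous_clamp
  unfold stateLeft; fun_prop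

theorem continuous_stateRight : Continuous fun z : ℝ × ℝ => stateRight z.1 z.2 := by
  have := continuous_rightDensity
  have := continuous_clamp
  unfold stateRight; fun_prop

theorem crossing_of_lt {p : ℝ} (h : p < 1) (q : ℝ) : crossing p q = stateLeft p q := if_pos h

theorem crossing_of_le {p : ℝ} (h : 1 ≤ p) (q : ℝ) : crossing p q = stateRight p q :=
  if_neg (not_lt.2 h)

theorem continuousAt_crossing {z : ℝ × ℝ} (h : z.1 ≠ 1) :
    ContinuousAt (fun z : ℝ × ℝ => crossing z.1 z.2) z := by
  rcases lt_or_gt_of_ne h with h | h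
  · refine continuous_stateLeft.continuousAt.congr ?_
    filter_upwards [(isOpen_lt continuous_fst continuous_const).mem_nhds h] with y hy
    exact (crossing_of_lt hy _).symm
  · refine continuous_stateRight.continuousAt.congr ?_
    filter_upwards [(isOpen_lt continuous_const continuous_fst).mem_nhds h] with y hy
    exact (crossing_of_le (le_of_lt hy) _).symm

theorem rightDensity_zero : rightDensity 0 = 0 := by
  simp [rightDensity, shockParam, truncAbs, osc, shockRight]

theorem crossing_density_nonneg (p q : ℝ) : 0 ≤ (crossing p q).2 := by
  rcases lt_or_ge p 1 with h | h
  · rw [crossing_of_lt h]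
    have := leftDensity_nonneg q
    have := clamp_le_one p
    simp only [stateLeft]; linarith
  · rw [crossing_of_le h]
    exact add_nonneg (rightDensity_nonneg q) (clamp_nonneg _)

theorem crossing_density_pos {p q : ℝ} (h : p ≠ 1 ∨ q ≠ 0) : 0 < (crossing p q).2 := by
  rcases lt_trichotomy p 1 with hp | rfl | hp
  · rw [crossing_of_lt hp]
    have := leftDensity_nonneg q
    have : clamp p < 1 := max_lt one_pos (min_lt_of_left_lt hp)
    simp only [stateLeft]; linarith
  · rw [crossing_of_le le_rfl]
    exact add_pos_of_pos_of_nonneg (rightDensity_pos (h.resolve_left fun h => h rfl))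
      (clamp_nonneg _)
  · rw [crossing_of_le hp.le]
    exact add_pos_of_nonneg_of_pos (rightDensity_nonneg q) (clamp_pos (sub_pos.2 hp))

theorem crossing_bounds (p q : ℝ) : |(crossing p q).1| ≤ 3 ∧ (crossing p q).2 ≤ 3 := by
  have hA := leftDensity_nonneg q
  have hA' := leftDensity_le q
  have hB := rightDensity_nonneg q
  have hB' := rightDensity_le q
  have hp := clamp_nonneg p
  have hp' := clamp_le_one p
  have hr := clamp_nonneg (p - 1)
  have hr' := clamp_le_one (p - 1)
  rw [abs_le]
  rcases lt_or_ge p 1 with h | h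
  · rw [crossing_of_lt h]; simp only [stateLeft]
    refine ⟨⟨?_, ?_⟩, ?_⟩ <;> linarith
  · rw [crossing_of_le h]; simp only [stateRight]
    refine ⟨⟨?_, ?_⟩, ?_⟩ <;> linarith

/-- For `x ≤ 1/2` the unfinished rarefaction keeps the density at least 1/4; for larger `x` the
label is away from 0 and the shock densities themselves are bounded below. -/
theorem crossing_diag_density_ge (x : ℝ) : 1 / 40960 ≤ (crossing x x).2 := by
  rcases lt_or_ge x 1 with h | h
  · rw [crossing_of_lt h]; simp only [stateLeft]
    have := clamp_le_one x
    rcases le_total x (1 / 2) with h2 | h2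
    · have h3 : clamp x ≤ 1 / 2 := clamp_le_max.trans (max_le (by norm_num) h2)
      linarith [leftDensity_nonneg x]
    · linarith [leftDensity_ge_of_half_le h2]
  · rw [crossing_of_le h]; simp only [stateRight]
    linarith [rightDensity_ge_of_half_le (by linarith : 1 / 2 ≤ x), clamp_nonneg (x - 1)]

theorem w₁_crossing (p q : ℝ) :
    w₁ (crossing p q) = if p < 1 then 1 - clamp p else 1 + 2 * clamp (p - 1) := by
  split_ifs with h
  · rw [crossing_of_lt h]; simp only [w₁, stateLeft]; ring
  · rw [crossing_of_le (not_lt.1 h)]; simp only [w₁, stateRight]; ring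

theorem w₂_crossing (p q : ℝ) :
    w₂ (crossing p q) = if p < 1 then 2 * leftDensity q else 2 * rightDensity q - 1 := by
  split_ifs with h
  · rw [crossing_of_lt h]; simp only [w₂, stateLeft]; ring
  · rw [crossing_of_le (not_lt.1 h)]; simp only [w₂, stateRight]; ring

/-! ### Verification of the front tracking conditions -/

section FrontTracking

theorem riemannMiddle_self {U : State} (h : 0 < U.2) : RiemannMiddle U U U :=
  ⟨⟨h, h, Or.inl ⟨rfl, le_rfl⟩⟩, ⟨h, h, Or.inl ⟨rfl, le_rfl⟩⟩⟩

theorem riemannMiddle_shock {q : ℝ} (h : q ≠ 0) :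
    RiemannMiddle (stateLeft 1 q) (stateRight 1 q) (stateRight 1 q) := by
  have e : clamp (1 - 1 : ℝ) = 0 := clamp_of_nonpos (by norm_num)
  have hL : stateLeft 1 q = (shockLeft (shockParam q), shockLeft (shockParam q)) := by
    simp [stateLeft, clamp_of_one_le le_rfl, leftDensity]
  have hR : stateRight 1 q = (shockRight (shockParam q) - 1, shockRight (shockParam q)) := by
    simp only [stateRight, e, rightDensity, sub_zero, add_zero]
  have hw := wave₁_shock (shockParam_pos h) (shockParam_mem q).2
  rw [hL, hR]
  exact ⟨hw, ⟨hw.2.1, hw.2.1, Or.inl ⟨rfl, le_rfl⟩⟩⟩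

theorem continuousAt_solution {c t x : ℝ} (h : x + c * t ≠ 1) :
    ContinuousAt (fun z : ℝ × ℝ => solution c z.1 z.2) (t, x) :=
  ContinuousAt.comp (g := fun z : ℝ × ℝ => crossing z.1 z.2)
    (f := fun z : ℝ × ℝ => (z.2 + c * z.1, z.2 - c * z.1)) (continuousAt_crossing h) (by fun_prop)

theorem continuousAt_solution_slice {c t x : ℝ} (h : x + c * t ≠ 1) :
    ContinuousAt (solution c t) x :=
  ContinuousAt.comp (g := fun z : ℝ × ℝ => solution c z.1 z.2) (f := fun x => (t, x))
    (continuousAt_solution h) (by fun_prop)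

theorem continuous_stateLeft_lines (c : ℝ) :
    Continuous fun z : ℝ × ℝ => stateLeft (z.2 + c * z.1) (z.2 - c * z.1) :=
  continuous_stateLeft.comp (f := fun z : ℝ × ℝ => (z.2 + c * z.1, z.2 - c * z.1)) (by fun_prop)

theorem continuous_stateRight_lines (c : ℝ) :
    Continuous fun z : ℝ × ℝ => stateRight (z.2 + c * z.1) (z.2 - c * z.1) :=
  continuous_stateRight.comp (f := fun z : ℝ × ℝ => (z.2 + c * z.1, z.2 - c * z.1)) (by fun_prop)

theorem tendsto_solution_left {c t x : ℝ} (h : x + c * t = 1) :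
    Tendsto (solution c t) (𝓝[<] x) (𝓝 (stateLeft 1 (x - c * t))) := by
  have hc : Continuous fun y => stateLeft (y + c * t) (y - c * t) :=
    (continuous_stateLeft_lines c).comp (f := fun y => (t, y)) (by fun_prop)
  have := (hc.tendsto x).mono_left (nhdsWithin_le_nhds (s := Iio x))
  simp only [h] at this
  refine this.congr' ?_
  filter_upwards [self_mem_nhdsWithin] with y hy
  exact (crossing_of_lt (by have : y < x := hy; linarith) _).symm

theorem tendsto_solution_sector {c t x : ℝ} (h : x + c * t = 1) :
    Tendsto (fun z : ℝ × ℝ => solution c z.1 z.2) (𝓝[upperSector c t x] (t, x))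
      (𝓝 (stateRight 1 (x - c * t))) := by
  have := ((continuous_stateRight_lines c).tendsto (t, x)).mono_left
    (nhdsWithin_le_nhds (s := upperSector c t x))
  simp only [h] at this
  refine this.congr' ?_
  filter_upwards [self_mem_nhdsWithin] with z hz
  have := (abs_lt.1 hz.2).1
  exact (crossing_of_le (by linarith) _).symm

theorem continuousWithinAt_solution (c t x : ℝ) :
    ContinuousWithinAt (solution c t) (Ici x) x := by
  rcases lt_or_ge (x + c * t) 1 with h | h
  · exact (continuousAt_solution_slice h.ne).continuousWithinAt
  · have hc : Continuous fun y => stateRight (y + c * t) (y - c * t) :=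
      (continuous_stateRight_lines c).comp (f := fun y => (t, y)) (by fun_prop)
    refine hc.continuousWithinAt.congr (fun y hy => ?_) ?_
    · exact crossing_of_le (by have : x ≤ y := hy; linarith) _
    · exact crossing_of_le h _

theorem isFrontTracking_solution {c : ℝ} (hc : 0 < c) : IsFrontTracking c (solution c) := by
  refine ⟨fun t _ x => crossing_density_nonneg _ _, fun t _ x => continuousWithinAt_solution c t x,
    fun t _ x hpos => ?_, {1}, ∅, ?_, ?_, ?_⟩
  · by_cases h : x + c * t = 1
    · have e : solution c t x = stateRight 1 (x - c * t) := by
        rw [solution, h, crossing_of_le le_rfl]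
      -- On the shock, `q = 0` is the vacuum point, excluded by positivity of the density.
      have hq : x - c * t ≠ 0 := fun hq => by
        rw [e, hq] at hpos
        simp [stateRight, rightDensity_zero, clamp] at hpos
      rw [e]
      exact ⟨_, _, tendsto_solution_left h, tendsto_solution_sector h, riemannMiddle_shock hq⟩
    · exact ⟨_, _, (continuousAt_solution_slice h).tendsto.mono_left nhdsWithin_le_nhds,
        (continuousAt_solution h).tendsto.mono_left nhdsWithin_le_nhds, riemannMiddle_self hpos⟩
  · intro t _ x hA _
    exact continuousAt_solution_slice (by simpa using hA)
  · intro y _ t t' _ _ _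
    simp only [solution, w₁_crossing, sub_add_cancel]
  · intro y _ t t' ht htt' hA
    simp only [solution, w₂_crossing, add_sub_cancel_right]
    -- A 2-line changes side only by meeting the shock, at time `(1 - y) / (2 c)`; hence both ends
    -- see the same branch of `w₂`.
    have hiff : y + c * t' + c * t' < 1 ↔ y + c * t + c * t < 1 := by
      constructor
      · intro h
        nlinarith
      · intro h
        by_contra hn
        refine hA ((1 - y) / (2 * c)) ⟨?_, ?_⟩ ?_
        · rw [le_div_iff₀ (by positivity)]; linarith
        · rw [div_le_iff₀ (by positivity)]; linarith
        · rw [Finset.mem_singleton]; field_simp; ring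
    simp only [hiff]

end FrontTracking

/-! ### Variation before, near and after the blow-up -/

section TotalVariation

theorem boundedVariationOn_w₁_solution (c t : ℝ) :
    BoundedVariationOn (fun x => w₁ (solution c t x)) univ := by
  have hg : BoundedVariationOn
      (fun p => (if p < 1 then 1 else 2 : ℝ) + 2 * clamp (p - 1)) univ := by
    refine boundedVariationOn_of_monotone (a := 1) (b := 4) (fun p p' h => ?_)
      (fun p => ?_) (fun p => ?_)
    · have := clamp_mono (sub_le_sub_right h 1)
      split_ifs <;> linarith
    · have := clamp_nonneg (p - 1)
      split_ifs <;> linarith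
    · have := clamp_le_one (p - 1)
      split_ifs <;> linarith
  have hw : ∀ p q : ℝ, w₁ (crossing p q) =
      (if p < 1 then 1 else 2 : ℝ) + 2 * clamp (p - 1) - clamp p := by
    intro p q
    rw [w₁_crossing]
    split_ifs with h
    · rw [clamp_of_nonpos (x := p - 1) (by linarith)]; ring
    · rw [clamp_of_one_le (not_lt.1 h)]; ring
  refine boundedVariationOn_of_abs_sub_le_add (boundedVariationOn_comp_add hg (c * t))
    (boundedVariationOn_comp_add boundedVariationOn_clamp (c * t)) fun x _ y _ => ?_
  simp only [solution, hw]
  refine le_trans (le_of_eq ?_) (abs_sub _ _)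
  congr 1
  ring

/-- Right of the shock `q ≥ 1 - 2 c t > 0`, so `rightDensity` may be frozen below this value, which
removes its oscillation at 0. A step function then glues the two sides. -/
theorem boundedVariationOn_w₂_solution {c t : ℝ} (h0 : 0 ≤ c * t) (h1 : 2 * (c * t) < 1) :
    BoundedVariationOn (fun x => w₂ (solution c t x)) univ := by
  have ha : BoundedVariationOn (fun x => leftDensity (x + -(c * t))) univ :=
    boundedVariationOn_comp_add boundedVariationOn_leftDensity _
  have hb : BoundedVariationOn
      (fun x => rightDensity (max (x + -(c * t)) (1 - 2 * (c * t)))) univ :=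
    boundedVariationOn_comp_add
      (boundedVariationOn_rightDensity_max (by linarith) (by linarith)) (-(c * t))
  have hχ : BoundedVariationOn (fun x => if x + c * t < 1 then 0 else 1 : ℝ → ℝ) univ := by
    refine boundedVariationOn_of_monotone (a := 0) (b := 1) (fun x y h => ?_)
      (fun x => ?_) (fun x => ?_)
    · split_ifs <;> linarith
    · split_ifs <;> norm_num
    · split_ifs <;> norm_num
  have two : ∀ {f : ℝ → ℝ}, BoundedVariationOn f univ →
      BoundedVariationOn (fun x => 2 * f x) univ := fun hf =>
    boundedVariationOn_of_abs_sub_le_add hf hf fun x _ y _ => by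
      rw [← mul_sub, abs_mul, abs_two, two_mul]
  have hd : BoundedVariationOn (fun x => 2 * rightDensity (max (x + -(c * t))
      (1 - 2 * (c * t))) - 1 - 2 * leftDensity (x + -(c * t))) univ :=
    boundedVariationOn_of_abs_sub_le_add (two hb) (two ha) fun x _ y _ =>
      le_trans (le_of_eq (by congr 1; ring)) (abs_sub _ _)
  refine boundedVariationOn_of_abs_sub_le_add (two ha) (hχ.mul hd) fun x _ y _ => ?_
  refine le_trans (le_of_eq ?_) (abs_add_le _ _)
  have hw : ∀ x, w₂ (solution c t x) = 2 * leftDensity (x + -(c * t)) +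
      (if x + c * t < 1 then 0 else 1 : ℝ) * (2 * rightDensity (max (x + -(c * t))
      (1 - 2 * (c * t))) - 1 - 2 * leftDensity (x + -(c * t))) := by
    intro x
    rw [solution, w₂_crossing, sub_eq_add_neg]
    split_ifs with h
    · ring
    · rw [max_eq_left (by linarith)]; ring
  simp only [hw, Pi.mul_apply]
  congr 1
  ring

theorem boundedVariationOn_solution {c t : ℝ} (h0 : 0 ≤ c * t) (h1 : 2 * (c * t) < 1) :
    BoundedVariationOn (fun x => (solution c t x).1) univ ∧
      BoundedVariationOn (fun x => (solution c t x).2) univ := by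
  have hw₁ := boundedVariationOn_w₁_solution c t
  have hw₂ := boundedVariationOn_w₂_solution h0 h1
  refine ⟨boundedVariationOn_of_abs_sub_le_add hw₂ hw₁ fun x _ y _ => ?_,
    boundedVariationOn_of_abs_sub_le_add hw₂ hw₁ fun x _ y _ => ?_⟩
  · have h := abs_sub (w₂ (solution c t x) - w₂ (solution c t y))
      (w₁ (solution c t x) - w₁ (solution c t y))
    have e : w₂ (solution c t x) - w₂ (solution c t y) -
        (w₁ (solution c t x) - w₁ (solution c t y)) =
        2 * ((solution c t x).1 - (solution c t y).1) := by simp only [w₁, w₂]; ring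
    rw [e, abs_mul, abs_two] at h
    linarith [abs_nonneg ((solution c t x).1 - (solution c t y).1)]
  · have h := abs_add_le (w₂ (solution c t x) - w₂ (solution c t y))
      (w₁ (solution c t x) - w₁ (solution c t y))
    have e : w₂ (solution c t x) - w₂ (solution c t y) +
        (w₁ (solution c t x) - w₁ (solution c t y)) =
        2 * ((solution c t x).2 - (solution c t y).2) := by simp only [w₁, w₂]; ring
    rw [e, abs_mul, abs_two] at h
    linarith [abs_nonneg ((solution c t x).2 - (solution c t y).2)]

/-- On the right of the shock the density has the variation of the transmitted 2-waves, up to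
that of the 1-waves. -/
theorem eVariationOn_rightDensity_le {c t : ℝ} {T S : Set ℝ}
    (hT : ∀ q ∈ T, q + c * t ∈ S ∧ 1 ≤ q + 2 * (c * t)) :
    eVariationOn rightDensity T ≤ eVariationOn (fun x => (solution c t x).2) S + 1 := by
  have h1 : eVariationOn rightDensity T ≤
      eVariationOn (fun q => (solution c t (q + c * t)).2) T +
        eVariationOn (fun q => clamp (q + (2 * (c * t) - 1))) T := by
    refine eVariationOn_le_add fun x hx y hy => ?_
    have e : ∀ q ∈ T, (solution c t (q + c * t)).2 =
        rightDensity q + clamp (q + (2 * (c * t) - 1)) := fun q hq => by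
      rw [solution, crossing_of_le (by linarith [(hT q hq).2]), add_sub_cancel_right]
      simp only [stateRight]
      congr 2
      ring
    rw [e x hx, e y hy]
    refine le_trans (le_of_eq ?_) (abs_sub _ _)
    congr 1
    ring
  refine h1.trans (add_le_add ?_ ?_)
  · exact eVariationOn.comp_le_of_monotoneOn (fun x => (solution c t x).2) (fun q => q + c * t)
      (fun _ _ _ _ h => by simpa using h) fun q hq => (hT q hq).1
  · refine (eVariationOn.mono _ (subset_univ T)).trans ((eVariationOn_le_of_monotone
      (a := 0) (b := 1) (fun _ _ h => clamp_mono (by linarith)) (fun _ => clamp_nonneg _)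
      (fun _ => clamp_le_one _)).trans ?_)
    simp

theorem tendsto_eVariationOn_solution {c : ℝ} (hc : 0 < c) :
    Tendsto (fun t => eVariationOn (fun x => (solution c t x).2) univ)
      (𝓝[<] (1 / (2 * c))) (𝓝 ⊤) := by
  have hη : Tendsto (fun t => 1 - 2 * (c * t)) (𝓝[<] (1 / (2 * c))) (𝓝[>] 0) := by
    refine tendsto_nhdsWithin_iff.2 ⟨?_, ?_⟩
    · have h : Continuous fun t => 1 - 2 * (c * t) := by fun_prop
      have h2 := (h.tendsto (1 / (2 * c))).mono_left (nhdsWithin_le_nhds (s := Iio (1 / (2 * c))))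
      have e : 1 - 2 * (c * (1 / (2 * c))) = 0 := by field_simp; ring
      rwa [e] at h2
    · filter_upwards [self_mem_nhdsWithin] with t ht
      have := (lt_div_iff₀ (by positivity)).1 (mem_Iio.1 ht)
      show 0 < 1 - 2 * (c * t)
      linarith
  have h := tendsto_eVariationOn_rightDensity.comp hη
  refine ENNReal.tendsto_nhds_top_iff_nnreal.2 fun N => ?_
  filter_upwards [ENNReal.tendsto_nhds_top_iff_nnreal.1 h (N + 1)] with t ht
  -- At time `t` the labels right of the shock are those with `q ≥ 1 - 2 c t`. The 1-waves cost at
  -- most 1, hence `N + 1` above.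
  have h1 := eVariationOn_rightDensity_le (c := c) (t := t) (T := Ici (1 - 2 * (c * t)))
    (S := univ) fun q hq => ⟨mem_univ _, by linarith [mem_Ici.1 hq]⟩
  have h2 := ht.trans_le h1
  rw [ENNReal.coe_add, ENNReal.coe_one] at h2
  exact lt_of_add_lt_add_right h2

theorem eVariationOn_solution_eq_top {c : ℝ} (hc : 0 < c) :
    eVariationOn (fun x => (solution c (2 / c) x).2) (Ici 0) = ⊤ := by
  have e : c * (2 / c) = 2 := by field_simp
  have h := eVariationOn_rightDensity_le (c := c) (t := 2 / c) (T := Ioi 0) (S := Ici 0)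
    fun q hq => by
      have : 0 < q := hq
      rw [e]
      exact ⟨mem_Ici.2 (by linarith), by linarith⟩
  rw [eVariationOn_rightDensity_Ioi, top_le_iff, ENNReal.add_eq_top] at h
  exact h.resolve_right ENNReal.one_ne_top

end TotalVariation

end PSystem

/-! ### The theorem -/

theorem mainTheorem1 :
    ∃ (ubar rhobar : ℝ → ℝ) (rho0 : ℝ),
      BoundedVariationOn ubar univ ∧ BoundedVariationOn rhobar univ ∧
      0 < rho0 ∧ (∀ x, rho0 ≤ rhobar x) ∧
      ∀ c : ℝ, 0 < c → ∃ (U : ℝ → ℝ → PSystem.State) (t₂ x₂ t₃ : ℝ),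
        PSystem.IsFrontTracking c U ∧
        (∀ x, U 0 x = (ubar x, rhobar x)) ∧
        0 < t₂ ∧ t₂ < t₃ ∧
        (∀ t ≥ 0, ∀ x, (t, x) ≠ (t₂, x₂) → 0 < (U t x).2) ∧
        -- blow up at time `t₂`
        (∀ t ≥ 0, t < t₂ → BoundedVariationOn (fun x => (U t x).1) univ ∧
          BoundedVariationOn (fun x => (U t x).2) univ) ∧
        Tendsto (fun t => eVariationOn (fun x => (U t x).2) univ) (𝓝[<] t₂) (𝓝 ⊤) ∧
        -- infinite total variation at uniformly positive density, at time `t₃`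
        (∀ x ≥ 0, 1 ≤ (U t₃ x).2) ∧
        eVariationOn (fun x => (U t₃ x).2) (Ici 0) = ⊤ ∧
        -- no weight on wave strengths controls the total variation
        (∀ W₁ W₂ : PSystem.State × PSystem.State → ℝ, PSystem.IsWeight W₁ → PSystem.IsWeight W₂ →
          PSystem.weightedVariation W₁ W₂ (U 0) univ < ⊤ ∧
          PSystem.weightedVariation W₁ W₂ (U t₃) (Ici 0) = ⊤) := by
  -- At `t = 0` both labels equal `x`, so one initial profile serves every `c`.
  have h00 : ∀ c x : ℝ, PSystem.solution c 0 x = PSystem.crossing x x := fun c x => by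
    simp [PSystem.solution]
  have hbv := PSystem.boundedVariationOn_solution (c := 1) (t := 0) (by norm_num) (by norm_num)
  simp only [h00] at hbv
  refine ⟨fun x => (PSystem.crossing x x).1, fun x => (PSystem.crossing x x).2, 1 / 40960,
    hbv.1, hbv.2, by norm_num, PSystem.crossing_diag_density_ge, fun c hc => ?_⟩
  have hc2 : c * (2 / c) = 2 := by field_simp
  have hdens : ∀ x ≥ 0, 1 ≤ (PSystem.solution c (2 / c) x).2 := fun x hx => by
    rw [PSystem.solution, hc2, PSystem.crossing_of_le (by linarith)]
    simp only [PSystem.stateRight]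
    rw [PSystem.clamp_of_one_le (by linarith)]
    linarith [PSystem.rightDensity_nonneg (x - 2)]
  -- The point `(t₂, x₂)` solves `p = 1`, `q = 0`. At `t₃ = 2 / c` every `x ≥ 0` has `p ≥ 2`, past
  -- the whole compression.
  refine ⟨PSystem.solution c, 1 / (2 * c), 1 / 2, 2 / c, PSystem.isFrontTracking_solution hc,
    fun x => h00 c x, by positivity, ?_, fun t _ x hne => ?_, fun t ht ht2 => ?_,
    PSystem.tendsto_eVariationOn_solution hc, hdens, PSystem.eVariationOn_solution_eq_top hc,
    fun W₁ W₂ h₁ h₂ => ⟨?_, ?_⟩⟩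
  · rw [div_lt_div_iff₀ (by positivity) hc]; linarith
  · refine PSystem.crossing_density_pos (or_iff_not_imp_left.2 fun hp hq => hne ?_)
    rw [not_not] at hp
    refine Prod.ext ?_ ?_
    · show t = 1 / (2 * c)
      rw [eq_div_iff (by positivity)]; linarith
    · show x = 1 / 2
      linarith
  · rw [lt_div_iff₀ (by positivity)] at ht2
    exact PSystem.boundedVariationOn_solution (mul_nonneg hc.le ht) (by linarith)
  · refine PSystem.weightedVariation_lt_top h₁ h₂ (r := 1 / 40960) (M := 3) (by norm_num)
      (fun x _ => ?_) (PSystem.boundedVariationOn_w₁_solution c 0)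
      (PSystem.boundedVariationOn_w₂_solution (by norm_num) (by norm_num))
    rw [h00]
    exact ⟨(PSystem.crossing_bounds x x).1, PSystem.crossing_diag_density_ge x,
      (PSystem.crossing_bounds x x).2⟩
  · exact PSystem.weightedVariation_eq_top h₁ h₂ (r := 1) (M := 3) one_pos
      (fun x hx => ⟨(PSystem.crossing_bounds _ _).1, hdens x hx, (PSystem.crossing_bounds _ _).2⟩)
      (PSystem.eVariationOn_solution_eq_top hc)
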